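/- **Theorem.** Let $\sigma$ be a first-order vocabulary. A *parametric grammar* $G=(\mathcal X,\mathcal N,P,S)$ over $\sigma$ has a finite set $\mathcal X$ of parameters, a finite set $\mathcal N$ of nonterminals, a start symbol $S\in\mathcal N$, and a finite set $P$ of productions $(A,\alpha,\gamma)$, where $A\in\mathcal N$, $\alpha$ is a finite sequence of nonterminals, parameters and local variables (from a set $\mathcal Y$), and the guard $\gamma$ is a quantifier-free $\sigma$-formula with equality over $\mathcal X\cup\mathcal Y$. Given a $\sigma$-structure with non-empty universe $D$ and an interpretation $X:\mathcal X\to D$, a derivation step rewrites $\beta A\beta'$ to $\beta\alpha'\beta'$, where $(A,\alpha,\gamma)\in P$, $Y:\mathcal Y\to D$ (chosen anew in each step) satisfies $D\models\gamma(X,Y)$, and $\alpha'$ is obtained from $\alpha$ by replacing parameters and local variables by their values under $X$ and $Y$. $L_X(G)\subseteq D^*$ is the set of words derivable from $S$, and $L(G)=\bigcup_X L_X(G)$. For a sequence $\Psi=(\psi_1,\dots,\psi_n)$ of quantifier-free $\sigma$-formulas in one variable, $P_\Psi(L(G))$ is the set of all $f:\{1,\dots,n\}\to\mathbb N$ for which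 there is $w\in L(G)$ such that, for every $i$, $f(i)$ is the number of positions of $w$ whose letter satisfies $\psi_i$. An *existential $T+\mathrm{QFPresburger}$ formula* $\varphi(x_1,\dots,x_n)$ is a block of existential quantifiers over variables ranging over $D$ and variables ranging over $\mathbb N$, followed by a Boolean combination of quantifier-free $\sigma$-formulas in the former variables and quantifier-free formulas of Presburger arithmetic $(\mathbb N;0,1,+,=)$ in the latter and in $x_1,\dots,x_n$. The size of a formula is its number of symbol occurrences (plus the number of quantified variables), and the size of a grammar is $$|G|=|\mathcal X|+|\mathcal N|+\sum_{(A,\alpha,\gamma)\in P}(1+|\alpha|+|\gamma|).$$ There is a polynomial $p$ such that for every $\sigma$, every parametric grammar $G$ over $\sigma$ and every sequence $\Psi=(\psi_1,\dots,\psi_n)$ as above there is an existential $T+\mathrm{QFPresburger}$ formula $\varphi(x_1,\dots,x_n)$ of size at most $p(|G|+n)\cdot\bigl(1+\sum_{i=1}^n|\psi_i|\bigr)$ such that, in every $\sigma$-structure with non-empty universe $D$ and for every $f:\{1,\dots,n\}\to\mathbb N$, $$f\in P_\Psi(L(G))\iff \varphi(f(1),\dots,f(n))\text{ holds}.$$ 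-/

import Mathlib

namespace ParametricParikh

universe u v

/-! ### Quantifier-free formulas and their size -/

/-- The number of symbol occurrences in a term. -/
def termSize {L : FirstOrder.Language.{u, v}} {α : Type*} : L.Term α → ℕ
  | .var _ => 1
  | .func _ ts => 1 + ∑ i, termSize (ts i)

/-- The number of symbol occurrences in a first-order formula. -/
def formulaSize {L : FirstOrder.Language.{u, v}} {α : Type*} : {k : ℕ} → L.BoundedFormula α k → ℕ
  | _, .falsum => 1
  | _, .equal s t => 1 + termSize s + termSize t
  | _, .rel _ ts => 1 + ∑ i, termSize (ts i)
  | _, .imp φ ψ => 1 + formulaSize φ + formulaSize ψ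
  | _, .all φ => 1 + formulaSize φ

/-- Quantifier-free formulas (with equality) over the vocabulary `L` whose variables and
uninterpreted constants are taken from `α`. -/
abbrev QFFormula (L : FirstOrder.Language.{u, v}) (α : Type*) := {φ : L.Formula α // φ.IsQF}

/-- The size of a quantifier-free formula. -/
def QFFormula.size {L : FirstOrder.Language.{u, v}} {α : Type*} (φ : QFFormula L α) : ℕ :=
  formulaSize φ.1

/-- Truth of a quantifier-free formula in the structure `D` under the assignment `a`. -/
def QFFormula.Holds {L : FirstOrder.Language.{u, v}} {α : Type*} (φ : QFFormula L α)
    {D : Type*} [L.Structure D] (a : α → D) : Prop :=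
  φ.1.Realize a

/-! ### Combination with quantifier-free Presburger arithmetic -/

/-- Boolean combinations of quantifier-free formulas of the theory of `L` (variables `α`) and
quantifier-free formulas of Presburger arithmetic (variables `β`). -/
inductive CombinedFormula (L : FirstOrder.Language.{u, v}) (α β : Type*)
  | theory (φ : QFFormula L α)
  | presburger (φ : QFFormula FirstOrder.Language.presburger β)
  | not (φ : CombinedFormula L α β)
  | and (φ ψ : CombinedFormula L α β)
  | or (φ ψ : CombinedFormula L α β)

namespace CombinedFormula

variable {L : FirstOrder.Language.{u, v}} {α β : Type*}

/-- The size of a combined formula. -/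
def size : CombinedFormula L α β → ℕ
  | theory φ => φ.size
  | presburger φ => φ.size
  | not φ => 1 + φ.size
  | and φ ψ => 1 + φ.size + ψ.size
  | or φ ψ => 1 + φ.size + ψ.size

/-- Truth of a combined formula: the variables in `α` range over the structure `D`, those in `β`
over the natural numbers with `0`, `1`, `+`. -/
def Holds {D : Type*} [L.Structure D] (a : α → D) (b : β → ℕ) : CombinedFormula L α β → Prop
  | theory φ => φ.Holds a
  | presburger φ => φ.Holds b
  | not φ => ¬ φ.Holds a b
  | and φ ψ => φ.Holds a b ∧ ψ.Holds a b
  | or φ ψ => φ.Holds a b ∨ ψ.Holds a b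

end CombinedFormula

/-- An existential formula of the combined theory with `n` free arithmetic variables
`x_1, …, x_n`: a block of existentially quantified variables of both sorts followed by a
quantifier-free formula. -/
structure ExistentialFormula (L : FirstOrder.Language.{u, v}) (n : ℕ) where
  /-- number of quantified variables ranging over the structure -/
  numDomain : ℕ
  /-- number of quantified arithmetic variables -/
  numArith : ℕ
  /-- the quantifier-free part -/
  matrix : CombinedFormula L (Fin numDomain) (Fin n ⊕ Fin numArith)

namespace ExistentialFormula

variable {L : FirstOrder.Language.{u, v}} {n : ℕ}

/-- The size of an existential formula: quantified variables plus the quantifier-free part. -/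
def size (φ : ExistentialFormula L n) : ℕ :=
  φ.numDomain + φ.numArith + φ.matrix.size

/-- `φ(f(1), …, f(n))` holds over the structure `D`. -/
def Holds (φ : ExistentialFormula L n) (D : Type*) [L.Structure D] (f : Fin n → ℕ) : Prop :=
  ∃ (a : Fin φ.numDomain → D) (b : Fin φ.numArith → ℕ), φ.matrix.Holds a (Sum.elim f b)

end ExistentialFormula

/-! ### Parametric context-free grammars -/

/-- Symbols on the right-hand side of a production: parameters, local variables and
nonterminals. -/
inductive RhsSymbol (X Y N : Type*)
  | param (x : X)
  | var (y : Y)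
  | nonterminal (A : N)

/-- A production `(A, α, φ)` with parameters `X`, local variables `Y` and nonterminals `N`. -/
structure Production (L : FirstOrder.Language.{u, v}) (X Y N : Type*) where
  /-- the nonterminal `A` -/
  lhs : N
  /-- the sequence `α` -/
  rhs : List (RhsSymbol X Y N)
  /-- the guard `φ` -/
  guard : QFFormula L (X ⊕ Y)

/-- The size of a production. -/
def Production.size {L : FirstOrder.Language.{u, v}} {X Y N : Type*} (r : Production L X Y N) : ℕ :=
  1 + r.rhs.length + r.guard.size

/-- A parametric grammar over the vocabulary `L`. -/
structure ParametricGrammar (L : FirstOrder.Language.{u, v}) (X Y N : Type*) where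
  /-- the starting symbol -/
  start : N
  /-- the finite set of productions -/
  productions : Finset (Production L X Y N)

/-- The value of a right-hand side symbol under interpretations of the parameters and local
variables. -/
def RhsSymbol.instantiate {X Y N D : Type*} (ξ : X → D) (η : Y → D) :
    RhsSymbol X Y N → Symbol D N
  | param x => .terminal (ξ x)
  | var y => .terminal (η y)
  | nonterminal A => .nonterminal A

namespace ParametricGrammar

variable {L : FirstOrder.Language.{u, v}} {X Y N : Type*}

/-- The size of a parametric grammar. -/
def size [Fintype X] [Fintype N] (G : ParametricGrammar L X Y N) : ℕ :=
  Fintype.card X + Fintype.card N + ∑ r ∈ G.productions, r.size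

variable {D : Type*} [L.Structure D]

/-- One derivation step `β A β' ⟶ β α' β'` under the interpretation `ξ` of the parameters. The
local variables are interpreted anew (by `η`) in each step. -/
def Step (G : ParametricGrammar L X Y N) (ξ : X → D) (s t : List (Symbol D N)) : Prop :=
  ∃ r ∈ G.productions, ∃ η : Y → D, r.guard.Holds (Sum.elim ξ η) ∧
    ∃ β β' : List (Symbol D N), s = β ++ [Symbol.nonterminal r.lhs] ++ β' ∧
      t = β ++ r.rhs.map (RhsSymbol.instantiate ξ η) ++ β'

/-- The language `L_ξ(G)` for a fixed interpretation `ξ` of the parameters. -/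
def languageAt (G : ParametricGrammar L X Y N) (ξ : X → D) : Set (List D) :=
  {w | Relation.ReflTransGen (G.Step ξ) [Symbol.nonterminal G.start] (w.map Symbol.terminal)}

/-- The language `L(G)` over the structure `D`: the union of `L_ξ(G)` over all `ξ`. -/
def language (G : ParametricGrammar L X Y N) (D : Type*) [L.Structure D] : Set (List D) :=
  ⋃ ξ : X → D, G.languageAt ξ

end ParametricGrammar

/-! ### The predicate-counting Parikh image -/

open Classical in
/-- The number of positions of `w` whose letter satisfies `ψ`, a formula in one variable. -/
noncomputable def countOf {L : FirstOrder.Language.{u, v}} {D : Type*} [L.Structure D]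
    (ψ : QFFormula L Unit) (w : List D) : ℕ :=
  w.countP fun c => decide (ψ.Holds fun _ => c)

/-- The Parikh image `P_Ψ(K)` of a set of words `K`. -/
def parikhImage {L : FirstOrder.Language.{u, v}} {D : Type*} [L.Structure D] {n : ℕ}
    (Ψ : Fin n → QFFormula L Unit) (K : Set (List D)) : Set (Fin n → ℕ) :=
  {f | ∃ w ∈ K, ∀ i, f i = countOf (Ψ i) w}

end ParametricParikh

universe u v uX uY uN w

/-!
Up to the order of letters, a derivation is a multiset of instances of productions. By the
Euler-type criterion for context-free grammars (Esparza; Verma, Seidl and Schwentick), a multiset of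
productions can be fired from the start symbol exactly if every nonterminal is produced as often as
it is rewritten and every rewritten nonterminal is reachable from the start symbol; reachability is
certified by a depth function, so both conditions are existential Presburger conditions.

A derivation may use unboundedly many interpretations of the local variables. Each instance,
however, contributes to the production counts and the letter counts only a vector of small entries,
and an integer Carathéodory argument in the style of Eisenbrand and Shmonin shows that such a sum of
vectors needs only polynomially many distinct instances: if two sets of instances have the same sum,
one can be traded for the other until an instance disappears, and otherwise the `2 ^ s` subsets of
the `s` instances have distinct sums in a small box. The formula therefore guesses the parameters,
polynomially many copies of the local variables, and how often each production is used with each of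
them.
-/

namespace ParametricParikh

open FirstOrder FirstOrder.Language

section IntegerCaratheodory

theorem le_of_two_pow_le_mul_add_one_pow {s B d : ℕ} (h : 2 ^ s ≤ (s * B + 1) ^ d) :
    s ≤ 4 * d ^ 2 * (B + 1) := by
  rcases Nat.eq_zero_or_pos s with rfl | hs
  · simp
  set y := Nat.sqrt (s * B + 1)
  have base_le : s * B + 1 ≤ 2 ^ (2 * y) :=
    calc s * B + 1 ≤ (y + 1) * (y + 1) := (Nat.lt_succ_sqrt _).le
      _ ≤ 2 ^ y * 2 ^ y := Nat.mul_le_mul Nat.lt_two_pow_self Nat.lt_two_pow_self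
      _ = 2 ^ (2 * y) := by rw [← pow_add, two_mul]
  have le_sqrt : s ≤ 2 * y * d := by
    refine (Nat.pow_le_pow_iff_right (a := 2) one_lt_two).1 ?_
    rw [pow_mul]
    exact h.trans (Nat.pow_le_pow_left base_le d)
  have sq_le : s * s ≤ s * (4 * d ^ 2 * (B + 1)) :=
    calc s * s ≤ (2 * y * d) * (2 * y * d) := Nat.mul_le_mul le_sqrt le_sqrt
      _ = 4 * d ^ 2 * (y * y) := by ring
      _ ≤ 4 * d ^ 2 * (s * B + 1) := Nat.mul_le_mul_left _ (Nat.sqrt_le _)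
      _ ≤ 4 * d ^ 2 * (s * B + s) := by gcongr; exact hs
      _ = s * (4 * d ^ 2 * (B + 1)) := by ring
  exact Nat.le_of_mul_le_mul_left sq_le hs

variable {Z M : Type*}

theorem exists_card_toFinset_lt [DecidableEq Z] [AddCommMonoid M] (v : Z → M) {K : Multiset Z}
    {S T : Finset Z} (hS : S ⊆ K.toFinset) (hT : T ⊆ K.toFinset) (hST : Disjoint S T)
    (hne : S.Nonempty) (hsum : ∑ z ∈ S, v z = ∑ z ∈ T, v z) :
    ∃ K' : Multiset Z, K' ⊆ K ∧ (K'.map v).sum = (K.map v).sum ∧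
      K'.toFinset.card < K.toFinset.card := by
  -- Trade `c` copies of `S` for `c` copies of `T`, where `c` is the least multiplicity on `S`.
  obtain ⟨a, ha, hmin⟩ := S.exists_min_image (fun z => K.count z) hne
  set c := K.count a with hc
  have hle : c • S.val ≤ K := by
    rw [Multiset.le_iff_count]
    intro z
    rw [Multiset.count_nsmul, Multiset.count_eq_of_nodup S.nodup]
    split_ifs with hz
    · simpa using hmin z hz
    · simp
  have hsub : K - c • S.val + c • T.val ⊆ K := by
    intro z hz
    rcases Multiset.mem_add.1 hz with hz | hz
    · exact Multiset.mem_of_le (Multiset.sub_le_self _ _) hz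
    · exact Multiset.mem_toFinset.1 (hT (Multiset.mem_of_mem_nsmul hz))
  refine ⟨K - c • S.val + c • T.val, hsub, ?_, ?_⟩
  · calc ((K - c • S.val + c • T.val).map v).sum
        = ((K - c • S.val).map v).sum + c • ∑ z ∈ T, v z := by
          simp [Multiset.map_nsmul, Multiset.sum_nsmul]
      _ = ((K - c • S.val + c • S.val).map v).sum := by
          simp [← hsum, Multiset.map_nsmul, Multiset.sum_nsmul]
      _ = (K.map v).sum := by rw [tsub_add_cancel_of_le hle]
  · have ha' : a ∉ K - c • S.val + c • T.val := by
      have haT : a ∉ T := Finset.disjoint_left.1 hST ha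
      simp [← Multiset.count_eq_zero, Multiset.count_nsmul,
        Multiset.count_eq_of_nodup S.nodup, ha, haT, ← hc]
    refine Finset.card_lt_card ((Finset.ssubset_iff_of_subset ?_).2 ⟨a, hS ha, ?_⟩)
    · exact Multiset.toFinset_subset.2 hsub
    · rwa [Multiset.mem_toFinset]

theorem exists_injOn_subset_sum [DecidableEq Z] [AddCancelCommMonoid M] (v : Z → M)
    (K : Multiset Z) :
    ∃ K' : Multiset Z, K' ⊆ K ∧ (K'.map v).sum = (K.map v).sum ∧
      Set.InjOn (fun S => ∑ z ∈ S, v z) (K'.toFinset.powerset : Set (Finset Z)) := by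
  induction hk : K.toFinset.card using Nat.strong_induction_on generalizing K with
  | _ s ih =>
    subst hk
    by_cases hinj : Set.InjOn (fun S => ∑ z ∈ S, v z) (K.toFinset.powerset : Set (Finset Z))
    · exact ⟨K, Multiset.Subset.refl K, rfl, hinj⟩
    obtain ⟨S, hS, T, hT, hst, hne⟩ : ∃ S ⊆ K.toFinset, ∃ T ⊆ K.toFinset,
        ∑ z ∈ S, v z = ∑ z ∈ T, v z ∧ S ≠ T := by
      simpa [Set.InjOn, Set.subset_def, Finset.subset_iff] using hinj
    have hdiff : ∑ z ∈ S \ T, v z = ∑ z ∈ T \ S, v z := by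
      have splitS := Finset.sum_inter_add_sum_sdiff S T v
      have splitT := Finset.sum_inter_add_sum_sdiff T S v
      rw [Finset.inter_comm] at splitT
      exact add_left_cancel (splitS.trans (hst.trans splitT.symm))
    have hS' : S \ T ⊆ K.toFinset := Finset.sdiff_subset.trans hS
    have hT' : T \ S ⊆ K.toFinset := Finset.sdiff_subset.trans hT
    obtain ⟨K', hsub, hsum, hlt⟩ : ∃ K' : Multiset Z, K' ⊆ K ∧
        (K'.map v).sum = (K.map v).sum ∧ K'.toFinset.card < K.toFinset.card := by
      rcases (S \ T).eq_empty_or_nonempty with hempty | hnonempty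
      · refine exists_card_toFinset_lt v hT' hS' disjoint_sdiff_sdiff ?_ hdiff.symm
        exact Finset.sdiff_nonempty.2 fun h =>
          hne (h.antisymm' (Finset.sdiff_eq_empty_iff_subset.1 hempty))
      · exact exists_card_toFinset_lt v hS' hT' disjoint_sdiff_sdiff hnonempty hdiff
    obtain ⟨K'', hsub', hsum', hinj'⟩ := ih _ hlt K' rfl
    exact ⟨K'', fun z hz => hsub (hsub' hz), hsum'.trans hsum, hinj'⟩

theorem card_toFinset_le_of_injOn_subset_sum {ι : Type*} [Fintype ι] [DecidableEq Z]
    (v : Z → ι → ℕ) {B : ℕ} {K : Multiset Z} (hB : ∀ z ∈ K, ∀ i, v z i ≤ B)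
    (hinj : Set.InjOn (fun S => ∑ z ∈ S, v z) (K.toFinset.powerset : Set (Finset Z))) :
    K.toFinset.card ≤ 4 * Fintype.card ι ^ 2 * (B + 1) := by
  classical
  set s := K.toFinset.card with hs
  have hmaps : ∀ S ∈ K.toFinset.powerset,
      ∑ z ∈ S, v z ∈ Fintype.piFinset fun _ : ι => Finset.range (s * B + 1) := by
    intro S hS
    rw [Finset.mem_powerset] at hS
    refine Fintype.mem_piFinset.2 fun i => ?_
    rw [Finset.mem_range, Nat.lt_succ_iff, Finset.sum_apply]
    calc ∑ z ∈ S, v z i ≤ S.card * B :=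
          Finset.sum_le_card_nsmul _ _ _ fun z hz => hB z (Multiset.mem_toFinset.1 (hS hz)) i
      _ ≤ s * B := Nat.mul_le_mul_right _ (Finset.card_le_card hS)
  have hcard := Finset.card_le_card_of_injOn _ hmaps hinj
  exact le_of_two_pow_le_mul_add_one_pow (by simpa [← hs] using hcard)

theorem exists_fin_nsmul_sum_eq [DecidableEq Z] [Nonempty Z] [AddCommMonoid M] (v : Z → M)
    {K : Multiset Z} {m : ℕ} (hm : K.toFinset.card ≤ m) :
    ∃ (c : Fin m → ℕ) (z : Fin m → Z), (∀ j, c j = 0 ∨ z j ∈ K) ∧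
      ∑ j, c j • v (z j) = (K.map v).sum := by
  obtain ⟨e⟩ : Nonempty (K.toFinset ↪ Fin m) :=
    Function.Embedding.nonempty_of_card_le (by rwa [Fintype.card_coe, Fintype.card_fin])
  refine ⟨Function.extend e (fun y => K.count y.1) 0,
    Function.extend e Subtype.val fun _ => Classical.arbitrary Z, fun j => ?_, ?_⟩
  · by_cases hj : ∃ y, e y = j
    · obtain ⟨y, rfl⟩ := hj
      exact .inr (by simpa [e.injective.extend_apply] using Multiset.mem_toFinset.1 y.2)
    · exact .inl (Function.extend_apply' _ _ _ hj)
  · rw [Finset.sum_multiset_map_count, ← Finset.sum_coe_sort K.toFinset]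
    refine (Fintype.sum_of_injective e e.injective _ _ (fun j hj => ?_) fun y => ?_).symm
    · rw [Function.extend_apply' _ _ _ hj, Pi.zero_apply, zero_nsmul]
    · simp only [e.injective.extend_apply]

theorem exists_fin_weights_of_le [Nonempty Z] {ι : Type*} [Fintype ι] (v : Z → ι → ℕ) {B m : ℕ}
    (hm : 4 * Fintype.card ι ^ 2 * (B + 1) ≤ m) {K : Multiset Z} (hB : ∀ z ∈ K, ∀ i, v z i ≤ B) :
    ∃ (c : Fin m → ℕ) (z : Fin m → Z), (∀ j, c j = 0 ∨ z j ∈ K) ∧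
      ∑ j, c j • v (z j) = (K.map v).sum := by
  classical
  obtain ⟨K', hsub, hsum, hinj⟩ := exists_injOn_subset_sum v K
  have hcard := card_toFinset_le_of_injOn_subset_sum v (fun z hz => hB z (hsub hz)) hinj
  obtain ⟨c, z, hz, hc⟩ := exists_fin_nsmul_sum_eq v (hcard.trans hm)
  exact ⟨c, z, fun j => (hz j).imp_right fun h => hsub h, hc.trans hsum⟩

end IntegerCaratheodory

section CommutativeDerivations

variable {P N : Type*}

/-- `Fires lhs out M K`: the rules in `K` can be applied in some order, each once, to rewrite the
multiset `M` of nonterminals to the empty multiset. A rule `r` replaces `lhs r` by `out r`. -/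
inductive Fires (lhs : P → N) (out : P → Multiset N) : Multiset N → Multiset P → Prop
  | nil : Fires lhs out 0 0
  | cons (r : P) {M : Multiset N} {K : Multiset P} (h : Fires lhs out (M + out r) K) :
      Fires lhs out (lhs r ::ₘ M) (r ::ₘ K)

/-- Reachability of a nonterminal from those in `M` along the edges from `lhs r` to the elements
of `out r`, for `r ∈ K`. -/
inductive Reachable (lhs : P → N) (out : P → Multiset N) (M : Multiset N) (K : Multiset P) :
    N → Prop
  | of_mem {A : N} (hA : A ∈ M) : Reachable lhs out M K A
  | step {r : P} {A : N} (hr : r ∈ K) (h : Reachable lhs out M K (lhs r)) (hA : A ∈ out r) :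
      Reachable lhs out M K A

variable {lhs : P → N} {out : P → Multiset N} {M : Multiset N} {K : Multiset P}

namespace Reachable

theorem cons {r : P} {A : N} (h : Reachable lhs out (M + out r) K A) :
    Reachable lhs out (lhs r ::ₘ M) (r ::ₘ K) A := by
  induction h with
  | of_mem hA =>
    rcases Multiset.mem_add.1 hA with hA | hA
    · exact .of_mem (Multiset.mem_cons_of_mem hA)
    · exact .step (Multiset.mem_cons_self r K) (.of_mem (Multiset.mem_cons_self _ M)) hA
  | step hq _ hA ih => exact .step (Multiset.mem_cons_of_mem hq) ih hA

theorem of_cons {r : P} (hr : lhs r ∈ K.map lhs → Reachable lhs out (M + out r) K (lhs r)) {A : N}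
    (h : Reachable lhs out (lhs r ::ₘ M) (r ::ₘ K) A) :
    A = lhs r ∨ Reachable lhs out (M + out r) K A := by
  induction h with
  | of_mem hA =>
    exact (Multiset.mem_cons.1 hA).imp_right fun hA => .of_mem (Multiset.mem_add.2 (.inl hA))
  | @step q A hq _ hA ih =>
    refine .inr ?_
    rcases Multiset.mem_cons.1 hq with rfl | hq
    · exact .of_mem (Multiset.mem_add.2 (.inr hA))
    · rcases ih with heq | h
      · exact .step hq (heq ▸ hr (heq ▸ Multiset.mem_map_of_mem lhs hq)) hA
      · exact .step hq h hA

theorem exists_rule {A B : N} (h : Reachable lhs out (A ::ₘ M) K B) (hA : A ∈ K.map lhs) :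
    B = A ∨ ∃ r K', lhs r = A ∧ K = r ::ₘ K' ∧ Reachable lhs out (M + out r) K' B := by
  induction h with
  | of_mem hB =>
    refine (Multiset.mem_cons.1 hB).imp_right fun hB => ?_
    obtain ⟨r, hr, hrA⟩ := Multiset.mem_map.1 hA
    obtain ⟨K', hK'⟩ := Multiset.exists_cons_of_mem hr
    exact ⟨r, K', hrA, hK', .of_mem (Multiset.mem_add.2 (.inl hB))⟩
  | @step q B hq _ hB ih =>
    refine .inr ?_
    by_cases hqA : lhs q = A
    · obtain ⟨K', hK'⟩ := Multiset.exists_cons_of_mem hq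
      exact ⟨q, K', hqA, hK', .of_mem (Multiset.mem_add.2 (.inr hB))⟩
    · obtain ⟨r, K', rfl, rfl, h⟩ := ih.resolve_left hqA
      have hqK' : q ∈ K' := (Multiset.mem_cons.1 hq).resolve_left fun hqr => hqA (hqr ▸ rfl)
      exact ⟨r, K', rfl, rfl, .step hqK' h hB⟩

end Reachable

theorem exists_rule_keeping_reachable {A : N} (hbal : (A ::ₘ M) + (K.map out).sum = K.map lhs)
    (hreach : ∀ r ∈ K, Reachable lhs out (A ::ₘ M) K (lhs r)) :
    ∃ r K', lhs r = A ∧ K = r ::ₘ K' ∧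
      (A ∈ K'.map lhs → Reachable lhs out (M + out r) K' A) := by
  have hA : A ∈ K.map lhs := hbal ▸ Multiset.mem_add.2 (.inl (Multiset.mem_cons_self A M))
  obtain ⟨r₀, hr₀, hr₀A⟩ := Multiset.mem_map.1 hA
  obtain ⟨K₀, rfl⟩ := Multiset.exists_cons_of_mem hr₀
  by_cases hneeded : A ∈ K₀.map lhs
  swap
  · exact ⟨r₀, K₀, hr₀A, rfl, fun h => absurd h hneeded⟩
  have hsource : A ∈ M + ((r₀ ::ₘ K₀).map out).sum := by
    rw [Multiset.map_cons lhs, hr₀A, Multiset.cons_add, Multiset.cons_inj_right] at hbal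
    rwa [hbal]
  rcases Multiset.mem_add.1 hsource with hAM | hAout
  · exact ⟨r₀, K₀, hr₀A, rfl, fun _ => .of_mem (Multiset.mem_add.2 (.inl hAM))⟩
  obtain ⟨t, ht, hAt⟩ : ∃ t ∈ r₀ ::ₘ K₀, A ∈ out t := Multiset.mem_bind.1 hAout
  rcases (hreach t ht).exists_rule hA with htA | ⟨r, K', hrA, hK', h⟩
  · obtain ⟨K', hK'⟩ := Multiset.exists_cons_of_mem ht
    exact ⟨t, K', htA, hK', fun _ => .of_mem (Multiset.mem_add.2 (.inr hAt))⟩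
  · refine ⟨r, K', hrA, hK', fun _ => ?_⟩
    rcases Multiset.mem_cons.1 (hK' ▸ ht) with rfl | htK'
    · exact .of_mem (Multiset.mem_add.2 (.inr hAt))
    · exact .step htK' h hAt

theorem fires_of_balanced_of_reachable (hbal : M + (K.map out).sum = K.map lhs)
    (hreach : ∀ r ∈ K, Reachable lhs out M K (lhs r)) : Fires lhs out M K := by
  induction hk : K.card generalizing K M with
  | zero =>
    obtain rfl := Multiset.card_eq_zero.1 hk
    obtain rfl : M = 0 := by simpa using hbal
    exact .nil
  | succ s ih =>
    have hM : M ≠ 0 := by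
      rintro rfl
      have not_reachable : ∀ B, ¬ Reachable lhs out 0 K B := fun B hB => by
        induction hB with
        | of_mem hB => exact Multiset.notMem_zero _ hB
        | step _ _ _ ih => exact ih
      have hK : K ≠ 0 := Multiset.card_pos.1 (by omega)
      obtain ⟨r, hr⟩ := Multiset.exists_mem_of_ne_zero hK
      exact not_reachable _ (hreach r hr)
    obtain ⟨A, hA⟩ := Multiset.exists_mem_of_ne_zero hM
    obtain ⟨M, rfl⟩ := Multiset.exists_cons_of_mem hA
    obtain ⟨r, K, rfl, rfl, hr⟩ := exists_rule_keeping_reachable hbal hreach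
    refine .cons r (ih ?_ (fun q hq => ?_) (by simpa using hk))
    · simpa [add_assoc] using hbal
    · rcases (hreach q (Multiset.mem_cons_of_mem hq)).of_cons hr with heq | h
      · exact heq ▸ hr (heq ▸ Multiset.mem_map_of_mem lhs hq)
      · exact h

theorem Fires.balanced (h : Fires lhs out M K) : M + (K.map out).sum = K.map lhs := by
  induction h with
  | nil => simp
  | cons r _ ih => simpa [add_assoc] using ih

theorem Fires.reachable (h : Fires lhs out M K) {r : P} (hr : r ∈ K) :
    Reachable lhs out M K (lhs r) := by
  induction h with
  | nil => exact absurd hr (Multiset.notMem_zero r)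
  | cons q _ ih =>
    rcases Multiset.mem_cons.1 hr with rfl | hr
    · exact .of_mem (Multiset.mem_cons_self _ _)
    · exact (ih hr).cons

theorem fires_iff_balanced_and_reachable :
    Fires lhs out M K ↔
      M + (K.map out).sum = K.map lhs ∧ ∀ r ∈ K, Reachable lhs out M K (lhs r) :=
  ⟨fun h => ⟨h.balanced, fun _ => h.reachable⟩,
    fun h => fires_of_balanced_of_reachable h.1 h.2⟩

/-- Reachability, as in `Reachable`, by a path with exactly the given number of edges. -/
def ReachableIn (lhs : P → N) (out : P → Multiset N) (M : Multiset N) (K : Multiset P) :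
    ℕ → N → Prop
  | 0, A => A ∈ M
  | n + 1, A => ∃ r ∈ K, ReachableIn lhs out M K n (lhs r) ∧ A ∈ out r

theorem Reachable.exists_reachableIn {A : N} (h : Reachable lhs out M K A) :
    ∃ n, ReachableIn lhs out M K n A := by
  induction h with
  | of_mem hA => exact ⟨0, hA⟩
  | step hr _ hA ih =>
    obtain ⟨n, hn⟩ := ih
    exact ⟨n + 1, _, hr, hn, hA⟩

theorem Reachable.exists_depth (lhs : P → N) (out : P → Multiset N) (M : Multiset N)
    (K : Multiset P) :
    ∃ d : N → ℕ, ∀ A, Reachable lhs out M K A →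
      A ∈ M ∨ ∃ r ∈ K, A ∈ out r ∧ d A = d (lhs r) + 1 := by
  set dist : N → ℕ := fun A => sInf {n | ReachableIn lhs out M K n A}
  have dist_le {n : ℕ} {A : N} (h : ReachableIn lhs out M K n A) : dist A ≤ n := Nat.sInf_le h
  have reachableIn_dist {n : ℕ} {A : N} (h : ReachableIn lhs out M K n A) :
      ReachableIn lhs out M K (dist A) A :=
    Nat.sInf_mem (s := {n | ReachableIn lhs out M K n A}) ⟨n, h⟩
  refine ⟨dist, fun A hA => ?_⟩
  obtain ⟨n, hn⟩ := hA.exists_reachableIn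
  have hmin := reachableIn_dist hn
  rcases hd : dist A with _ | k
  · exact .inl (by rwa [hd] at hmin)
  · rw [hd] at hmin
    obtain ⟨r, hr, hk, hAr⟩ := hmin
    have dist_lhs_le : dist (lhs r) ≤ k := dist_le hk
    have dist_le_succ : dist A ≤ dist (lhs r) + 1 := dist_le ⟨r, hr, reachableIn_dist hk, hAr⟩
    exact .inr ⟨r, hr, hAr, by omega⟩

theorem reachable_of_depth (d : N → ℕ)
    (hd : ∀ r ∈ K, lhs r ∈ M ∨ ∃ r' ∈ K, lhs r ∈ out r' ∧ d (lhs r) = d (lhs r') + 1)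
    {r : P} (hr : r ∈ K) : Reachable lhs out M K (lhs r) := by
  induction hn : d (lhs r) using Nat.strong_induction_on generalizing r with
  | _ n ih =>
    rcases hd r hr with hM | ⟨r', hr', hout, hlt⟩
    · exact .of_mem hM
    · exact .step hr' (ih _ (by omega) hr' rfl) hout

theorem fires_iff_exists_depth :
    Fires lhs out M K ↔ M + (K.map out).sum = K.map lhs ∧
      ∃ d : N → ℕ, ∀ r ∈ K,
        lhs r ∈ M ∨ ∃ r' ∈ K, lhs r ∈ out r' ∧ d (lhs r) = d (lhs r') + 1 := by
  rw [fires_iff_balanced_and_reachable]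
  refine and_congr_right fun _ => ⟨fun h => ?_, fun ⟨d, hd⟩ r hr => reachable_of_depth d hd hr⟩
  obtain ⟨d, hd⟩ := Reachable.exists_depth lhs out M K
  exact ⟨d, fun r hr => hd _ (h r hr)⟩

theorem sum_nsmul_balanced_iff [DecidableEq N] [Fintype P] (M : Multiset N) (t : P → ℕ) :
    M + ((∑ r, t r • ({r} : Multiset P)).map out).sum =
        (∑ r, t r • ({r} : Multiset P)).map lhs ↔
      ∀ A, M.count A + ∑ r, t r * (out r).count A = ∑ r with lhs r = A, t r := by
  have hout : ((∑ r, t r • ({r} : Multiset P)).map out).sum = ∑ r, t r • out r := by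
    simp only [← Multiset.coe_mapAddMonoidHom, ← Multiset.coe_sumAddMonoidHom, map_sum, map_nsmul]
    simp
  have hlhs : (∑ r, t r • ({r} : Multiset P)).map lhs = ∑ r, t r • {lhs r} := by
    simp [← Multiset.coe_mapAddMonoidHom, map_sum, map_nsmul]
  simp only [hout, hlhs, Multiset.ext, Multiset.count_add, Multiset.count_sum',
    Multiset.count_nsmul, Multiset.count_singleton, mul_ite, mul_one, mul_zero,
    Finset.sum_filter, eq_comm]

theorem fires_sum_nsmul_iff [DecidableEq N] [Fintype P] (start : N) (t : P → ℕ) :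
    Fires lhs out {start} (∑ r, t r • ({r} : Multiset P)) ↔
      (∀ A, (if A = start then 1 else 0) + ∑ r, t r * (out r).count A =
        ∑ r with lhs r = A, t r) ∧
      ∃ d : N → ℕ, ∀ r, lhs r ≠ start → t r = 0 ∨
        ∃ r', lhs r ∈ out r' ∧ t r' ≠ 0 ∧ d (lhs r) = d (lhs r') + 1 := by
  have mem_iff (r : P) : r ∈ ∑ r, t r • ({r} : Multiset P) ↔ t r ≠ 0 := by
    simp [Multiset.mem_sum, Multiset.mem_nsmul]
  rw [fires_iff_exists_depth, sum_nsmul_balanced_iff]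
  simp only [mem_iff, Multiset.mem_singleton, Multiset.count_singleton]
  refine and_congr_right fun _ => exists_congr fun d => forall_congr' fun r => ?_
  grind

end CommutativeDerivations

section SententialForms

variable {X Y N D : Type*}

/-- The multiset of letters of a sentential form. -/
def terminals (s : List (Symbol D N)) : Multiset D :=
  s.filterMap fun
    | .terminal c => some c
    | .nonterminal _ => none

/-- The multiset of nonterminals of a sentential form. -/
def nonterminals (s : List (Symbol D N)) : Multiset N :=
  s.filterMap fun
    | .terminal _ => none
    | .nonterminal A => some A

/-- The nonterminal that a right-hand side symbol contributes to every instance of it. -/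
def RhsSymbol.nonterminal? : RhsSymbol X Y N → Option N
  | param _ => none
  | var _ => none
  | nonterminal A => some A

@[simp] theorem terminals_append (s t : List (Symbol D N)) :
    terminals (s ++ t) = terminals s + terminals t := by
  simp [terminals]

@[simp] theorem nonterminals_append (s t : List (Symbol D N)) :
    nonterminals (s ++ t) = nonterminals s + nonterminals t := by
  simp [nonterminals]

@[simp] theorem terminals_nonterminal (A : N) :
    terminals [(.nonterminal A : Symbol D N)] = 0 := rfl

@[simp] theorem nonterminals_nonterminal (A : N) :
    nonterminals [(.nonterminal A : Symbol D N)] = {A} := rfl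

@[simp] theorem terminals_map_terminal (w : List D) :
    terminals (w.map .terminal : List (Symbol D N)) = w := by
  simp [terminals, List.filterMap_map]

@[simp] theorem nonterminals_map_terminal (w : List D) :
    nonterminals (w.map .terminal : List (Symbol D N)) = 0 := by
  simp [nonterminals, List.filterMap_map]

theorem nonterminals_append_nonterminal_append (β β' : List (Symbol D N)) (A : N) :
    nonterminals (β ++ [.nonterminal A] ++ β') = A ::ₘ (nonterminals β + nonterminals β') := by
  simp only [nonterminals_append, nonterminals_nonterminal, ← Multiset.singleton_add]
  abel

theorem nonterminals_map_instantiate (ξ : X → D) (η : Y → D) (α : List (RhsSymbol X Y N)) :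
    nonterminals (α.map (RhsSymbol.instantiate ξ η)) = α.filterMap RhsSymbol.nonterminal? := by
  rw [nonterminals, List.filterMap_map]
  congr 2
  funext x
  cases x <;> rfl

theorem exists_eq_map_terminal {s : List (Symbol D N)} (h : nonterminals s = 0) :
    ∃ w : List D, s = w.map .terminal := by
  induction s with
  | nil => exact ⟨[], rfl⟩
  | cons a s ih =>
    cases a with
    | terminal c =>
      obtain ⟨w, rfl⟩ := ih h
      exact ⟨c :: w, rfl⟩
    | nonterminal A => simp [nonterminals] at h

theorem exists_eq_append_of_mem_nonterminals {s : List (Symbol D N)} {A : N}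
    (h : A ∈ nonterminals s) : ∃ β β', s = β ++ [.nonterminal A] ++ β' := by
  have hmem : Symbol.nonterminal A ∈ s := by
    obtain ⟨a, ha, haA⟩ := List.mem_filterMap.1 (Multiset.mem_coe.1 h)
    cases a with
    | terminal => cases haA
    | nonterminal => cases haA; exact ha
  obtain ⟨β, β', rfl⟩ := List.append_of_mem hmem
  exact ⟨β, β', by simp⟩

end SententialForms

namespace ParametricGrammar

variable {L : FirstOrder.Language.{u, v}} {X Y N : Type*} (G : ParametricGrammar L X Y N)

/-- The left-hand side of a production of `G`. -/
def lhs (r : G.productions) : N := r.1.lhs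

/-- The multiset of nonterminals on the right-hand side of a production of `G`. -/
def out (r : G.productions) : Multiset N := r.1.rhs.filterMap RhsSymbol.nonterminal?

variable {D : Type*}

/-- The multiset of letters on the right-hand side of a production whose local variables are
interpreted by the second component of `z`. -/
def yield (ξ : X → D) (z : G.productions × (Y → D)) : Multiset D :=
  terminals (z.1.1.rhs.map (RhsSymbol.instantiate ξ z.2))

variable [L.Structure D]

/-- The guard of the production `z.1` holds if `z.2` interprets its local variables. -/
def IsAdmissible (ξ : X → D) (z : G.productions × (Y → D)) : Prop :=
  z.1.1.guard.Holds (Sum.elim ξ z.2)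

variable {G}

theorem exists_fires_of_derives {ξ : X → D} {s : List (Symbol D N)} {w : List D}
    (h : Relation.ReflTransGen (G.Step ξ) s (w.map .terminal)) :
    ∃ K : Multiset (G.productions × (Y → D)), (∀ z ∈ K, G.IsAdmissible ξ z) ∧
      Fires G.lhs G.out (nonterminals s) (K.map Prod.fst) ∧
      (w : Multiset D) = terminals s + (K.map (G.yield ξ)).sum := by
  induction h using Relation.ReflTransGen.head_induction_on with
  | refl => exact ⟨0, by simp, by simpa using Fires.nil, by simp⟩
  | head hstep _ ih =>
    obtain ⟨K, hK, hfires, hw⟩ := ih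
    obtain ⟨r, hr, η, hη, β, β', rfl, rfl⟩ := hstep
    refine ⟨(⟨r, hr⟩, η) ::ₘ K, ?_, ?_, ?_⟩
    · simpa [IsAdmissible] using ⟨hη, fun r hr η => hK (⟨r, hr⟩, η)⟩
    · rw [nonterminals_append_nonterminal_append, Multiset.map_cons]
      refine .cons (⟨r, hr⟩ : G.productions) ?_
      rwa [nonterminals_append, nonterminals_append, nonterminals_map_instantiate,
        add_right_comm] at hfires
    · rw [hw]
      simp only [terminals_append, terminals_nonterminal, Multiset.map_cons, Multiset.sum_cons,
        yield]
      abel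

theorem exists_derives_of_fires {ξ : X → D} {K : Multiset (G.productions × (Y → D))}
    (hK : ∀ z ∈ K, G.IsAdmissible ξ z) {s : List (Symbol D N)}
    (h : Fires G.lhs G.out (nonterminals s) (K.map Prod.fst)) :
    ∃ w : List D, Relation.ReflTransGen (G.Step ξ) s (w.map .terminal) ∧
      (w : Multiset D) = terminals s + (K.map (G.yield ξ)).sum := by
  generalize hM : nonterminals s = M, hR : K.map Prod.fst = R at h
  induction h generalizing s K with
  | nil =>
    obtain rfl : K = 0 := by simpa using hR
    obtain ⟨w, rfl⟩ := exists_eq_map_terminal hM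
    exact ⟨w, .refl, by simp⟩
  | @cons r M R _ ih =>
    obtain ⟨z, hz, rfl⟩ : ∃ z ∈ K, z.1 = r :=
      Multiset.mem_map.1 (hR ▸ Multiset.mem_cons_self r R)
    obtain ⟨K, rfl⟩ := Multiset.exists_cons_of_mem hz
    obtain rfl : K.map Prod.fst = R := by simpa using hR
    obtain ⟨β, β', rfl⟩ : ∃ β β', s = β ++ [.nonterminal z.1.1.lhs] ++ β' :=
      exists_eq_append_of_mem_nonterminals (hM ▸ Multiset.mem_cons_self _ M)
    have hsplit : nonterminals β + nonterminals β' = M := by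
      rwa [nonterminals_append_nonterminal_append, lhs, Multiset.cons_inj_right] at hM
    obtain ⟨w, hw, hletters⟩ := ih (fun q hq => hK q (Multiset.mem_cons_of_mem hq))
      (s := β ++ z.1.1.rhs.map (RhsSymbol.instantiate ξ z.2) ++ β')
      (by rw [nonterminals_append, nonterminals_append, nonterminals_map_instantiate,
        add_right_comm, hsplit, out]) rfl
    refine ⟨w, .head ⟨z.1.1, z.1.2, z.2, hK z hz, β, β', rfl, rfl⟩ hw, ?_⟩
    rw [hletters]
    simp only [terminals_append, terminals_nonterminal, Multiset.map_cons, Multiset.sum_cons,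
      yield]
    abel

open Classical in
/-- The number of letters satisfying `ψ` in the yield of `z`. -/
noncomputable def letterCount (ψ : QFFormula L Unit) (ξ : X → D)
    (z : G.productions × (Y → D)) : ℕ :=
  (G.yield ξ z).countP fun c => ψ.Holds fun _ => c

theorem countOf_eq_sum_letterCount (ψ : QFFormula L Unit) {ξ : X → D} {w : List D}
    {K : Multiset (G.productions × (Y → D))} (hw : (w : Multiset D) = (K.map (G.yield ξ)).sum) :
    countOf ψ w = (K.map (letterCount ψ ξ)).sum := by
  classical
  rw [countOf, ← Multiset.coe_countP, hw, ← Multiset.coe_countPAddMonoidHom, map_multiset_sum,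
    Multiset.map_map]
  rfl

theorem mem_parikhImage_iff_exists_fires {n : ℕ} (Ψ : Fin n → QFFormula L Unit)
    (f : Fin n → ℕ) :
    f ∈ parikhImage Ψ (G.language D) ↔
      ∃ (ξ : X → D) (K : Multiset (G.productions × (Y → D))), (∀ z ∈ K, G.IsAdmissible ξ z) ∧
        Fires G.lhs G.out {G.start} (K.map Prod.fst) ∧
        ∀ i, f i = (K.map (letterCount (Ψ i) ξ)).sum := by
  constructor
  · rintro ⟨w, hw, hf⟩
    obtain ⟨ξ, hw⟩ := Set.mem_iUnion.1 hw
    obtain ⟨K, hK, hfires, hletters⟩ := exists_fires_of_derives hw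
    exact ⟨ξ, K, hK, hfires, fun i =>
      (hf i).trans (countOf_eq_sum_letterCount _ (by simpa using hletters))⟩
  · rintro ⟨ξ, K, hK, hfires, hf⟩
    obtain ⟨w, hw, hletters⟩ := exists_derives_of_fires hK (s := [.nonterminal G.start]) hfires
    exact ⟨w, Set.mem_iUnion.2 ⟨ξ, hw⟩, fun i =>
      (hf i).trans (countOf_eq_sum_letterCount _ (by simpa using hletters)).symm⟩

open Classical in
theorem letterCount_le_length (ψ : QFFormula L Unit) (ξ : X → D)
    (z : G.productions × (Y → D)) : letterCount ψ ξ z ≤ z.1.1.rhs.length :=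
  calc letterCount ψ ξ z ≤ (G.yield ξ z).card := Multiset.countP_le_card _ _
    _ ≤ (z.1.1.rhs.map (RhsSymbol.instantiate ξ z.2)).length := List.length_filterMap_le _ _
    _ = z.1.1.rhs.length := List.length_map _

open Classical in
/-- The contribution of an instance of a production to the number of uses of every production and
to the number of letters satisfying every formula of `Ψ`. -/
noncomputable def contribution {n : ℕ} (Ψ : Fin n → QFFormula L Unit) (ξ : X → D)
    (z : G.productions × (Y → D)) : G.productions ⊕ Fin n → ℕ :=
  Sum.elim (fun r => ({z.1} : Multiset G.productions).count r) fun i => letterCount (Ψ i) ξ z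

theorem contribution_le {n : ℕ} (Ψ : Fin n → QFFormula L Unit) (ξ : X → D) {B : ℕ}
    (hB : ∀ r : G.productions, r.1.rhs.length ≤ B) (z : G.productions × (Y → D))
    (x : G.productions ⊕ Fin n) : contribution Ψ ξ z x ≤ B + 1 := by
  classical
  cases x with
  | inl r =>
    have hcount := Multiset.count_le_card r ({z.1} : Multiset G.productions)
    simp only [Multiset.card_singleton] at hcount
    simp only [contribution, Sum.elim_inl]
    omega
  | inr i => exact (letterCount_le_length _ ξ z).trans ((hB z.1).trans B.le_succ)

theorem exists_multiplicities {n m B : ℕ} {Ψ : Fin n → QFFormula L Unit}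
    (hB : ∀ r : G.productions, r.1.rhs.length ≤ B)
    (hm : 4 * (Fintype.card G.productions + n) ^ 2 * (B + 2) ≤ m) {ξ : X → D}
    {K : Multiset (G.productions × (Y → D))} (hne : K ≠ 0) (hK : ∀ z ∈ K, G.IsAdmissible ξ z) :
    ∃ (η : Fin m → Y → D) (k : G.productions → Fin m → ℕ),
      (∀ r j, k r j = 0 ∨ G.IsAdmissible ξ (r, η j)) ∧
      K.map Prod.fst = ∑ r, (∑ j, k r j) • ({r} : Multiset G.productions) ∧
      ∀ i, (K.map (letterCount (Ψ i) ξ)).sum =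
        ∑ r, ∑ j, k r j * letterCount (Ψ i) ξ (r, η j) := by
  classical
  obtain ⟨z₀, -⟩ := Multiset.exists_mem_of_ne_zero hne
  have : Nonempty (G.productions × (Y → D)) := ⟨z₀⟩
  obtain ⟨c, z, hz, hsum⟩ := exists_fin_weights_of_le (contribution Ψ ξ) (m := m) (K := K)
    (B := B + 1) (by simpa using hm) fun z _ => contribution_le Ψ ξ hB z
  have sum_apply (x : G.productions ⊕ Fin n) :
      ∑ j, c j * contribution Ψ ξ (z j) x = (K.map fun z => contribution Ψ ξ z x).sum := by
    have := congrArg (Pi.evalAddMonoidHom (fun _ => ℕ) x) hsum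
    simpa [map_multiset_sum, Multiset.map_map, Function.comp_def] using this
  refine ⟨fun j => (z j).2, fun r j => if (z j).1 = r then c j else 0, fun r j => ?_, ?_,
    fun i => ?_⟩
  · by_cases hr : (z j).1 = r
    · subst hr
      simpa using (hz j).imp_right (hK (z j))
    · exact .inl (if_neg hr)
  · ext r
    have hr : ∑ j, c j * Multiset.count r {(z j).1} =
        (K.map fun z => Multiset.count r {z.1}).sum := sum_apply (.inl r)
    rw [← Multiset.bind_singleton, Multiset.count_bind, ← hr]
    simp [Multiset.count_sum', Multiset.count_singleton, @eq_comm _ r]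
  · rw [Finset.sum_comm]
    simpa [contribution, ite_mul] using (sum_apply (.inr i)).symm

theorem mem_parikhImage_iff_exists_multiplicities {n m B : ℕ} {Ψ : Fin n → QFFormula L Unit}
    (hB : ∀ r : G.productions, r.1.rhs.length ≤ B)
    (hm : 4 * (Fintype.card G.productions + n) ^ 2 * (B + 2) ≤ m) (f : Fin n → ℕ) :
    f ∈ parikhImage Ψ (G.language D) ↔
      ∃ (ξ : X → D) (η : Fin m → Y → D) (k : G.productions → Fin m → ℕ),
        (∀ r j, k r j = 0 ∨ G.IsAdmissible ξ (r, η j)) ∧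
        Fires G.lhs G.out {G.start} (∑ r, (∑ j, k r j) • ({r} : Multiset G.productions)) ∧
        ∀ i, f i = ∑ r, ∑ j, k r j * letterCount (Ψ i) ξ (r, η j) := by
  rw [mem_parikhImage_iff_exists_fires]
  constructor
  · rintro ⟨ξ, K, hK, hfires, hf⟩
    have hne : K ≠ 0 := by
      rintro rfl
      simpa using hfires.balanced
    obtain ⟨η, k, hadm, hcount, hletters⟩ := exists_multiplicities (Ψ := Ψ) hB hm hne hK
    exact ⟨ξ, η, k, hadm, hcount ▸ hfires, fun i => (hf i).trans (hletters i)⟩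
  · rintro ⟨ξ, η, k, hadm, hfires, hf⟩
    refine ⟨ξ, ∑ r, ∑ j, k r j • {(r, η j)}, fun z hz => ?_, ?_, fun i => ?_⟩
    · obtain ⟨r, -, hr⟩ := Multiset.mem_sum.1 hz
      obtain ⟨j, -, hj⟩ := Multiset.mem_sum.1 hr
      obtain ⟨hk, hz⟩ := Multiset.mem_nsmul.1 hj
      exact Multiset.mem_singleton.1 hz ▸ (hadm r j).resolve_left hk
    · convert hfires
      simp [← Multiset.coe_mapAddMonoidHom, map_sum, map_nsmul, Finset.sum_smul]
    · simp only [← Multiset.coe_mapAddMonoidHom, ← Multiset.coe_sumAddMonoidHom, map_sum,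
        map_nsmul]
      simpa using hf i

end ParametricGrammar

section Renaming

variable {L : FirstOrder.Language.{u, v}} {α β α' β' : Type*}

@[simp] theorem termSize_relabel (g : α → β) (t : L.Term α) :
    termSize (t.relabel g) = termSize t := by
  induction t with
  | var => rfl
  | func f ts ih => simp [termSize, ih]

theorem formulaSize_relabel {k m : ℕ} {φ : L.BoundedFormula α k} (hφ : φ.IsQF)
    (g : α → β ⊕ Fin m) : formulaSize (φ.relabel g) = formulaSize φ := by
  induction hφ with
  | falsum => rfl
  | of_isAtomic hφ =>
    cases hφ with
    | equal s t =>
      change 1 + termSize (s.relabel _) + termSize (t.relabel _) = 1 + termSize s + termSize t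
      rw [termSize_relabel, termSize_relabel]
    | rel R ts =>
      change 1 + ∑ i, termSize ((ts i).relabel _) = 1 + ∑ i, termSize (ts i)
      simp only [termSize_relabel]
  | imp _ _ ihφ ihψ =>
    rw [BoundedFormula.relabel_imp, formulaSize, formulaSize, ihφ, ihψ]

/-- Renaming of the variables of a quantifier-free formula. -/
def QFFormula.rename (g : α → β) (φ : QFFormula L α) : QFFormula L β :=
  ⟨φ.1.relabel g, φ.2.relabel _⟩

@[simp] theorem QFFormula.size_rename (g : α → β) (φ : QFFormula L α) :
    (φ.rename g).size = φ.size :=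
  formulaSize_relabel φ.2 _

@[simp] theorem QFFormula.holds_rename {D : Type*} [L.Structure D] (g : α → β)
    (φ : QFFormula L α) (a : β → D) : (φ.rename g).Holds a ↔ φ.Holds (a ∘ g) :=
  Formula.realize_relabel

namespace CombinedFormula

/-- Renaming of the variables of a combined formula. -/
def rename (g : α → α') (h : β → β') : CombinedFormula L α β → CombinedFormula L α' β'
  | theory φ => theory (φ.rename g)
  | presburger φ => presburger (φ.rename h)
  | not φ => not (φ.rename g h)
  | and φ ψ => and (φ.rename g h) (ψ.rename g h)
  | or φ ψ => or (φ.rename g h) (ψ.rename g h)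

theorem size_rename (g : α → α') (h : β → β') (φ : CombinedFormula L α β) :
    (φ.rename g h).size = φ.size := by
  induction φ <;> simp_all [rename, size]

theorem holds_rename {D : Type*} [L.Structure D] (g : α → α') (h : β → β')
    (φ : CombinedFormula L α β) (a : α' → D) (b : β' → ℕ) :
    (φ.rename g h).Holds a b ↔ φ.Holds (a ∘ g) (b ∘ h) := by
  induction φ <;> simp_all [rename, Holds]

end CombinedFormula

end Renaming

section FreeVariables

variable {L : FirstOrder.Language.{u, v}} {α β : Type*}

theorem card_varFinsetLeft_le [DecidableEq α] (t : L.Term (α ⊕ β)) :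
    t.varFinsetLeft.card ≤ termSize t := by
  induction t with
  | var x => cases x <;> simp [Term.varFinsetLeft, termSize]
  | func f ts ih =>
    calc (Finset.univ.biUnion fun i => (ts i).varFinsetLeft).card
        ≤ ∑ i, (ts i).varFinsetLeft.card := Finset.card_biUnion_le
      _ ≤ ∑ i, termSize (ts i) := Finset.sum_le_sum fun i _ => ih i
      _ ≤ termSize (.func f ts) := Nat.le_add_left _ _

theorem card_freeVarFinset_le [DecidableEq α] {k : ℕ} (φ : L.BoundedFormula α k) :
    φ.freeVarFinset.card ≤ formulaSize φ := by
  induction φ with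
  | falsum => simp [BoundedFormula.freeVarFinset]
  | equal s t =>
    have hs := card_varFinsetLeft_le s
    have ht := card_varFinsetLeft_le t
    refine (Finset.card_union_le _ _).trans ?_
    rw [formulaSize]
    omega
  | rel R ts =>
    calc (Finset.univ.biUnion fun i => (ts i).varFinsetLeft).card
        ≤ ∑ i, (ts i).varFinsetLeft.card := Finset.card_biUnion_le
      _ ≤ ∑ i, termSize (ts i) := Finset.sum_le_sum fun i _ => card_varFinsetLeft_le (ts i)
      _ ≤ formulaSize (.rel R ts) := Nat.le_add_left _ _
  | imp φ ψ hφ hψ =>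
    refine (Finset.card_union_le _ _).trans ?_
    rw [formulaSize]
    omega
  | all φ hφ => exact hφ.trans (Nat.le_add_left _ _)

theorem QFFormula.holds_congr [DecidableEq α] {D : Type*} [L.Structure D] (φ : QFFormula L α)
    {a b : α → D} (h : Set.EqOn a b φ.1.freeVarFinset) : φ.Holds a ↔ φ.Holds b :=
  (BoundedFormula.realize_restrictFreeVar (f := Subtype.val) a fun _ => rfl).symm.trans <|
    BoundedFormula.realize_restrictFreeVar (f := Subtype.val) b fun x => h x.2

open Classical in
/-- The variables of both sorts occurring in a combined formula. -/
noncomputable def CombinedFormula.vars : CombinedFormula L α β → Finset (α ⊕ β)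
  | theory φ => φ.1.freeVarFinset.map .inl
  | presburger φ => φ.1.freeVarFinset.map .inr
  | not φ => φ.vars
  | and φ ψ => φ.vars ∪ ψ.vars
  | or φ ψ => φ.vars ∪ ψ.vars

theorem CombinedFormula.card_vars_le (φ : CombinedFormula L α β) : φ.vars.card ≤ φ.size := by
  classical
  induction φ with
  | theory φ => exact (Finset.card_map _).trans_le (card_freeVarFinset_le φ.1)
  | presburger φ => exact (Finset.card_map _).trans_le (card_freeVarFinset_le φ.1)
  | not φ ih => exact ih.trans (Nat.le_add_left _ _)
  | and φ ψ hφ hψ | or φ ψ hφ hψ =>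
    refine (Finset.card_union_le _ _).trans ?_
    rw [size]
    omega

theorem CombinedFormula.holds_congr {D : Type*} [L.Structure D] (φ : CombinedFormula L α β)
    {a a' : α → D} {b b' : β → ℕ} (ha : ∀ x, .inl x ∈ φ.vars → a x = a' x)
    (hb : ∀ y, .inr y ∈ φ.vars → b y = b' y) : φ.Holds a b ↔ φ.Holds a' b' := by
  classical
  induction φ with
  | theory φ => exact φ.holds_congr fun x hx => ha x (by simpa [vars] using hx)
  | presburger φ => exact φ.holds_congr fun y hy => hb y (by simpa [vars] using hy)
  | not φ ih => exact not_congr (ih ha hb)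
  | and φ ψ hφ hψ | or φ ψ hφ hψ =>
    simp only [vars, Finset.mem_union, or_imp, forall_and] at ha hb
    simp only [Holds, hφ ha.1 hb.1, hψ ha.2 hb.2]

theorem exists_injOn_fin_card_add_one {ι : Type*} (s : Finset ι) :
    ∃ g : ι → Fin (s.card + 1), Set.InjOn g s := by
  classical
  refine ⟨fun x => if hx : x ∈ s then (s.equivFin ⟨x, hx⟩).castSucc else Fin.last _, ?_⟩
  intro x hx y hy hxy
  simpa [Finset.mem_coe.1 hx, Finset.mem_coe.1 hy] using hxy

theorem exists_comp_eqOn_of_injOn {ι κ D : Type*} [Nonempty D] {s : Set ι} {g : ι → κ}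
    (hg : Set.InjOn g s) (a : ι → D) : ∃ a' : κ → D, Set.EqOn (a' ∘ g) a s := by
  obtain ⟨a', ha'⟩ := hg.injective.surjective_comp_right (s.domRestrict a)
  exact ⟨a', fun x hx => congrFun ha' ⟨x, hx⟩⟩

theorem exists_existentialFormula {n : ℕ} (φ : CombinedFormula L α (Fin n ⊕ β)) :
    ∃ χ : ExistentialFormula L n, χ.size ≤ 2 * φ.size + 2 ∧
      ∀ (D : Type w) [Nonempty D] [L.Structure D] (f : Fin n → ℕ),
        χ.Holds D f ↔ ∃ (a : α → D) (b : β → ℕ), φ.Holds a (Sum.elim f b) := by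
  obtain ⟨g, hg⟩ := exists_injOn_fin_card_add_one φ.vars.toLeft
  obtain ⟨h, hh⟩ := exists_injOn_fin_card_add_one φ.vars.toRight.toRight
  refine ⟨⟨_, _, φ.rename g (Sum.map id h)⟩, ?_, fun D _ _ f => ?_⟩
  · have hvars := φ.card_vars_le
    have hleft := φ.vars.card_toLeft_add_card_toRight
    have hright := φ.vars.toRight.card_toLeft_add_card_toRight
    simp only [ExistentialFormula.size, CombinedFormula.size_rename]
    omega
  · simp only [ExistentialFormula.Holds, CombinedFormula.holds_rename, Sum.elim_comp_map,
      Function.comp_id]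
    constructor
    · rintro ⟨a, b, hab⟩
      exact ⟨_, _, hab⟩
    · rintro ⟨a, b, hab⟩
      obtain ⟨a', ha'⟩ := exists_comp_eqOn_of_injOn hg a
      obtain ⟨b', hb'⟩ := exists_comp_eqOn_of_injOn hh b
      refine ⟨a', b', (φ.holds_congr (fun x hx => ha' (by simpa using hx)) ?_).2 hab⟩
      rintro (i | y) hy
      · rfl
      · exact hb' (by simpa using hy)

end FreeVariables

section Presburger

variable {L : FirstOrder.Language.{u, v}} {α β ι : Type*}

@[simp] theorem termSize_zero : termSize (0 : Language.presburger.Term α) = 1 := by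
  change 1 + ∑ i : Fin 0, _ = 1
  simp

@[simp] theorem termSize_one : termSize (1 : Language.presburger.Term α) = 1 := by
  change 1 + ∑ i : Fin 0, _ = 1
  simp

@[simp] theorem termSize_add (s t : Language.presburger.Term α) :
    termSize (s + t) = 1 + termSize s + termSize t := by
  change 1 + ∑ i : Fin 2, termSize (![s, t] i) = _
  simp [Fin.sum_univ_two, add_assoc]

@[simp] theorem termSize_sum (s : Finset ι) (t : ι → Language.presburger.Term α) :
    termSize (presburger.sum s t) = 1 + ∑ i ∈ s, (1 + termSize (t i)) := by
  rw [presburger.sum, ← Finset.sum_map_toList]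
  induction s.toList with
  | nil => simp
  | cons i l ih =>
    simp only [List.map_cons, List.sum_cons, termSize_add, ih]
    omega

@[simp] theorem termSize_nsmul (k : ℕ) (t : Language.presburger.Term α) :
    termSize (k • t) = 1 + k * (1 + termSize t) := by
  induction k with
  | zero => simp [presburger.zero_nsmul]
  | succ k ih =>
    rw [presburger.succ_nsmul, termSize_add, ih]
    ring

namespace CombinedFormula

/-- The equation between two Presburger terms. -/
def eq (s t : Language.presburger.Term β) : CombinedFormula L α β :=
  presburger ⟨(s.relabel Sum.inl).bdEqual (t.relabel Sum.inl), .of_isAtomic (.equal _ _)⟩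

@[simp] theorem size_eq (s t : Language.presburger.Term β) :
    (eq s t : CombinedFormula L α β).size = 1 + termSize s + termSize t := by
  change 1 + termSize (s.relabel _) + termSize (t.relabel _) = _
  rw [termSize_relabel, termSize_relabel]

/-- The true formula. -/
def top : CombinedFormula L α β := presburger ⟨⊤, .top⟩

/-- The conjunction of a finite family of formulas. -/
noncomputable def conj (s : Finset ι) (φ : ι → CombinedFormula L α β) : CombinedFormula L α β :=
  (s.toList.map φ).foldr and top

@[simp] theorem size_conj (s : Finset ι) (φ : ι → CombinedFormula L α β) :
    (conj s φ).size = 3 + ∑ i ∈ s, (1 + (φ i).size) := by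
  rw [conj, ← Finset.sum_map_toList]
  induction s.toList with
  | nil => rfl
  | cons i l ih =>
    simp only [List.map_cons, List.foldr_cons, List.sum_cons, size, ih]
    omega

/-- The disjunction of a finite family of formulas, expressed through `conj`. -/
noncomputable def disj (s : Finset ι) (φ : ι → CombinedFormula L α β) : CombinedFormula L α β :=
  not (conj s fun i => not (φ i))

@[simp] theorem size_disj (s : Finset ι) (φ : ι → CombinedFormula L α β) :
    (disj s φ).size = 4 + ∑ i ∈ s, (2 + (φ i).size) := by
  simp only [disj, size, size_conj, ← add_assoc]

/-- The conditional formula `if χ then φ else ψ`. -/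
def cond (χ φ ψ : CombinedFormula L α β) : CombinedFormula L α β :=
  or (and χ φ) (and (not χ) ψ)

@[simp] theorem size_cond (χ φ ψ : CombinedFormula L α β) :
    (cond χ φ ψ).size = 4 + 2 * χ.size + φ.size + ψ.size := by
  simp only [cond, size]
  omega

variable {D : Type*} [L.Structure D] (a : α → D) (b : β → ℕ)

@[simp] theorem holds_eq (s t : Language.presburger.Term β) :
    (eq s t : CombinedFormula L α β).Holds a b ↔ s.realize b = t.realize b := by
  simp [eq, Holds, QFFormula.Holds, Formula.Realize]

@[simp] theorem holds_top : (top : CombinedFormula L α β).Holds a b :=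
  BoundedFormula.realize_top.2 trivial

@[simp] theorem holds_conj (s : Finset ι) (φ : ι → CombinedFormula L α β) :
    (conj s φ).Holds a b ↔ ∀ i ∈ s, (φ i).Holds a b := by
  simp only [conj, ← Finset.mem_toList]
  induction s.toList with
  | nil => simp
  | cons i l ih => simp [Holds, ih]

@[simp] theorem holds_disj (s : Finset ι) (φ : ι → CombinedFormula L α β) :
    (disj s φ).Holds a b ↔ ∃ i ∈ s, (φ i).Holds a b := by
  simp [disj, Holds]

open Classical in
@[simp] theorem holds_cond (χ φ ψ : CombinedFormula L α β) :
    (cond χ φ ψ).Holds a b ↔ if χ.Holds a b then φ.Holds a b else ψ.Holds a b := by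
  split_ifs with hχ <;> simp [cond, Holds, hχ]

end CombinedFormula

end Presburger

section Encoding

variable {L : FirstOrder.Language.{u, v}} {X Y N : Type*}

/-- The formula stating that a right-hand side symbol is instantiated to a letter satisfying
`ψ`. -/
def RhsSymbol.letterFormula (ψ : QFFormula L Unit) : RhsSymbol X Y N → QFFormula L (X ⊕ Y)
  | param x => ψ.rename fun _ => .inl x
  | var y => ψ.rename fun _ => .inr y
  | nonterminal _ => ⟨⊥, .falsum⟩

theorem RhsSymbol.size_letterFormula_le (ψ : QFFormula L Unit) (x : RhsSymbol X Y N) :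
    (x.letterFormula ψ).size ≤ ψ.size + 1 := by
  cases x with
  | param | var => simp [letterFormula]
  | nonterminal => exact Nat.le_add_left _ _

namespace ParametricGrammar

open Classical in
theorem letterCount_eq_sum_ite {G : ParametricGrammar L X Y N} {D : Type*} [L.Structure D]
    (ψ : QFFormula L Unit) (ξ : X → D) (r : G.productions) (η : Y → D) :
    letterCount ψ ξ (r, η) = ∑ p : Fin r.1.rhs.length,
      if ((r.1.rhs[p]).letterFormula ψ).Holds (Sum.elim ξ η) then 1 else 0 := by
  refine .trans ?_ (Fin.sum_univ_fun_getElem r.1.rhs fun x =>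
    if (x.letterFormula ψ).Holds (Sum.elim ξ η) then 1 else 0).symm
  simp only [letterCount, yield, terminals, Multiset.coe_countP]
  induction r.1.rhs with
  | nil => rfl
  | cons x α ih =>
    rw [List.map_cons, List.map_cons, List.sum_cons, ← ih]
    cases x with
    | param | var =>
      simp [RhsSymbol.instantiate, RhsSymbol.letterFormula, List.countP_cons, add_comm,
        Function.comp_def]
    | nonterminal => simp [RhsSymbol.instantiate, RhsSymbol.letterFormula, QFFormula.Holds]

variable (G : ParametricGrammar L X Y N) (m n : ℕ)

/-- A position on the right-hand side of a production of `G`. -/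
abbrev Position := Σ r : G.productions, Fin r.1.rhs.length

/-- The quantified arithmetic variables of the formula for the Parikh image: the number of uses of
the production `r` under the `j`-th interpretation of the local variables, the number of letters
satisfying the `i`-th formula that these uses produce at the position `p`, and the depth of a
nonterminal. -/
inductive ArithVar
  | multiplicity (r : G.productions) (j : Fin m)
  | letters (p : G.Position) (j : Fin m) (i : Fin n)
  | depth (A : N)

/-- Combined formulas over the parameters, `m` copies of the local variables, `n` free arithmetic
variables and `ArithVar G m n`. -/
abbrev EncodingFormula := CombinedFormula L (X ⊕ Fin m × Y) (Fin n ⊕ G.ArithVar m n)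

/-- The formula stating that instances of productions used at least once satisfy their guards. -/
noncomputable def guardFormula : G.EncodingFormula m n :=
  .conj Finset.univ fun z : G.productions × Fin m =>
    .or (.eq (.var (.inr (.multiplicity z.1 z.2))) 0)
      (.theory (z.1.1.guard.rename (Sum.map id (Prod.mk z.2))))

/-- The formula defining the variables `ArithVar.letters`. -/
noncomputable def lettersFormula {n : ℕ} (Ψ : Fin n → QFFormula L Unit) : G.EncodingFormula m n :=
  .conj Finset.univ fun z : G.Position × Fin m =>
    .conj Finset.univ fun i =>
      .cond (.theory (((z.1.1.1.rhs[z.1.2]).letterFormula (Ψ i)).rename (Sum.map id (Prod.mk z.2))))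
        (.eq (.var (.inr (.letters z.1 z.2 i))) (.var (.inr (.multiplicity z.1.1 z.2))))
        (.eq (.var (.inr (.letters z.1 z.2 i))) 0)

/-- The number of uses of the production `r`. -/
noncomputable def usesTerm (r : G.productions) :
    Language.presburger.Term (Fin n ⊕ G.ArithVar m n) :=
  presburger.sum Finset.univ fun j => .var (.inr (.multiplicity r j))

open Classical in
/-- The formula stating that every nonterminal is produced as often as it is rewritten. -/
noncomputable def balanceFormula [Fintype N] : G.EncodingFormula m n :=
  .conj Finset.univ fun A =>
    .eq ((if A = G.start then 1 else 0) +
        presburger.sum Finset.univ fun r => (G.out r).count A • G.usesTerm m n r)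
      (presburger.sum {r | G.lhs r = A} (G.usesTerm m n))

open Classical in
/-- The formula stating that the left-hand side of every used production is the start symbol or
lies one level deeper than that of a used production which produces it. -/
noncomputable def connectivityFormula : G.EncodingFormula m n :=
  .conj {r | G.lhs r ≠ G.start} fun r =>
    .or (.eq (G.usesTerm m n r) 0) <|
      .disj {r' | G.lhs r ∈ G.out r'} fun r' =>
        .and (.not (.eq (G.usesTerm m n r') 0))
          (.eq (.var (.inr (.depth (G.lhs r)))) (.var (.inr (.depth (G.lhs r'))) + 1))

/-- The formula stating that the free variables are the total numbers of letters. -/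
noncomputable def imageFormula : G.EncodingFormula m n :=
  .conj Finset.univ fun i =>
    .eq (.var (.inl i)) <| presburger.sum Finset.univ fun z : G.Position × Fin m =>
      .var (.inr (.letters z.1 z.2 i))

/-- The quantifier-free part of the formula defining the Parikh image. -/
noncomputable def parikhFormula [Fintype N] {n : ℕ} (Ψ : Fin n → QFFormula L Unit) :
    G.EncodingFormula m n :=
  .and (G.guardFormula m n) <| .and (G.lettersFormula m Ψ) <| .and (G.balanceFormula m n) <|
    .and (G.connectivityFormula m n) (G.imageFormula m n)

section Semantics

variable {G m n} {D : Type*} [L.Structure D] (ξ : X → D) (η : Fin m → Y → D) (f : Fin n → ℕ)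
  (b : G.ArithVar m n → ℕ)

theorem holds_rename_copy (φ : QFFormula L (X ⊕ Y)) (j : Fin m) :
    (φ.rename (Sum.map id (Prod.mk j))).Holds (Sum.elim ξ (Function.uncurry η)) ↔
      φ.Holds (Sum.elim ξ (η j)) := by
  rw [QFFormula.holds_rename, Sum.elim_comp_map]
  rfl

@[simp] theorem realize_usesTerm (r : G.productions) :
    (G.usesTerm m n r).realize (Sum.elim f b) = ∑ j, b (.multiplicity r j) := by
  simp [usesTerm]

theorem holds_guardFormula :
    (G.guardFormula m n).Holds (Sum.elim ξ (Function.uncurry η)) (Sum.elim f b) ↔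
      ∀ r j, b (.multiplicity r j) = 0 ∨ G.IsAdmissible ξ (r, η j) := by
  simp only [guardFormula, CombinedFormula.holds_conj, CombinedFormula.Holds,
    CombinedFormula.holds_eq, holds_rename_copy, Finset.mem_univ, forall_const, Prod.forall,
    Term.realize_var, Sum.elim_inr, presburger.realize_zero, IsAdmissible]

open Classical in
theorem holds_lettersFormula (Ψ : Fin n → QFFormula L Unit) :
    (G.lettersFormula m Ψ).Holds (Sum.elim ξ (Function.uncurry η)) (Sum.elim f b) ↔
      ∀ p j i, b (.letters p j i) =
        if ((p.1.1.rhs[p.2]).letterFormula (Ψ i)).Holds (Sum.elim ξ (η j))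
        then b (.multiplicity p.1 j) else 0 := by
  simp only [lettersFormula, CombinedFormula.holds_conj, CombinedFormula.holds_cond,
    CombinedFormula.holds_eq, CombinedFormula.Holds, holds_rename_copy, Finset.mem_univ,
    forall_const, Prod.forall, Term.realize_var, Sum.elim_inr, presburger.realize_zero]
  refine forall₃_congr fun p j i => ?_
  split_ifs <;> rfl

open Classical in
theorem holds_balanceFormula [Fintype N] (a : X ⊕ Fin m × Y → D) :
    (G.balanceFormula m n).Holds a (Sum.elim f b) ↔
      ∀ A, (if A = G.start then 1 else 0) +
          ∑ r, (∑ j, b (.multiplicity r j)) * (G.out r).count A =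
        ∑ r with G.lhs r = A, ∑ j, b (.multiplicity r j) := by
  simp [balanceFormula, apply_ite (Term.realize _), mul_comm]

theorem holds_connectivityFormula (a : X ⊕ Fin m × Y → D) :
    (G.connectivityFormula m n).Holds a (Sum.elim f b) ↔
      ∀ r, G.lhs r ≠ G.start → ∑ j, b (.multiplicity r j) = 0 ∨
        ∃ r', G.lhs r ∈ G.out r' ∧ ∑ j, b (.multiplicity r' j) ≠ 0 ∧
          b (.depth (G.lhs r)) = b (.depth (G.lhs r')) + 1 := by
  simp only [connectivityFormula, CombinedFormula.holds_conj, CombinedFormula.Holds,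
    CombinedFormula.holds_disj, CombinedFormula.holds_eq, Finset.mem_filter_univ,
    realize_usesTerm, presburger.realize_zero, presburger.realize_add, presburger.realize_one,
    Term.realize_var, Sum.elim_inr, ne_eq]

theorem holds_imageFormula (a : X ⊕ Fin m × Y → D) :
    (G.imageFormula m n).Holds a (Sum.elim f b) ↔
      ∀ i, f i = ∑ z : G.Position × Fin m, b (.letters z.1 z.2 i) := by
  simp [imageFormula]

open Classical in
theorem sum_letters_eq (ψ : QFFormula L Unit) (k : G.productions → Fin m → ℕ) :
    (∑ z : G.Position × Fin m,
      if ((z.1.1.1.rhs[z.1.2]).letterFormula ψ).Holds (Sum.elim ξ (η z.2))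
      then k z.1.1 z.2 else 0) = ∑ r, ∑ j, k r j * letterCount ψ ξ (r, η j) := by
  simp only [letterCount_eq_sum_ite, Finset.mul_sum, mul_ite, mul_one, mul_zero]
  rw [Fintype.sum_prod_type, Fintype.sum_sigma]
  exact Finset.sum_congr rfl fun r _ => Finset.sum_comm

open Classical in
theorem holds_parikhFormula [Fintype N] (Ψ : Fin n → QFFormula L Unit) :
    (G.parikhFormula m Ψ).Holds (Sum.elim ξ (Function.uncurry η)) (Sum.elim f b) ↔
      (∀ r j, b (.multiplicity r j) = 0 ∨ G.IsAdmissible ξ (r, η j)) ∧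
      (∀ p j i, b (.letters p j i) =
        if ((p.1.1.rhs[p.2]).letterFormula (Ψ i)).Holds (Sum.elim ξ (η j))
        then b (.multiplicity p.1 j) else 0) ∧
      (∀ A, (if A = G.start then 1 else 0) +
          ∑ r, (∑ j, b (.multiplicity r j)) * (G.out r).count A =
        ∑ r with G.lhs r = A, ∑ j, b (.multiplicity r j)) ∧
      (∀ r, G.lhs r ≠ G.start → ∑ j, b (.multiplicity r j) = 0 ∨
        ∃ r', G.lhs r ∈ G.out r' ∧ ∑ j, b (.multiplicity r' j) ≠ 0 ∧
          b (.depth (G.lhs r)) = b (.depth (G.lhs r')) + 1) ∧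
      ∀ i, f i = ∑ z : G.Position × Fin m, b (.letters z.1 z.2 i) := by
  simp only [parikhFormula, CombinedFormula.Holds, holds_guardFormula, holds_lettersFormula,
    holds_balanceFormula, holds_connectivityFormula, holds_imageFormula]

theorem mem_parikhImage_iff_exists_holds [Fintype N] {B : ℕ} {Ψ : Fin n → QFFormula L Unit}
    (hB : ∀ r : G.productions, r.1.rhs.length ≤ B)
    (hm : 4 * (Fintype.card G.productions + n) ^ 2 * (B + 2) ≤ m) :
    f ∈ parikhImage Ψ (G.language D) ↔
      ∃ (a : X ⊕ Fin m × Y → D) (b : G.ArithVar m n → ℕ),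
        (G.parikhFormula m Ψ).Holds a (Sum.elim f b) := by
  classical
  simp only [mem_parikhImage_iff_exists_multiplicities hB hm, fires_sum_nsmul_iff]
  constructor
  · rintro ⟨ξ, η, k, hadm, ⟨hbal, d, hconn⟩, hf⟩
    let b : G.ArithVar m n → ℕ
      | .multiplicity r j => k r j
      | .letters p j i =>
        if ((p.1.1.rhs[p.2]).letterFormula (Ψ i)).Holds (Sum.elim ξ (η j)) then k p.1 j else 0
      | .depth A => d A
    refine ⟨Sum.elim ξ (Function.uncurry η), b, (holds_parikhFormula ξ η f b Ψ).2
      ⟨hadm, fun _ _ _ => rfl, hbal, hconn, fun i => ?_⟩⟩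
    exact (hf i).trans (sum_letters_eq ξ η (Ψ i) k).symm
  · rintro ⟨a, b, hab⟩
    obtain ⟨ξ, η, rfl⟩ : ∃ ξ η, a = Sum.elim ξ (Function.uncurry η) :=
      ⟨a ∘ .inl, fun j y => a (.inr (j, y)), by ext (x | z) <;> rfl⟩
    obtain ⟨hadm, hletters, hbal, hconn, hf⟩ := (holds_parikhFormula ξ η f b Ψ).1 hab
    refine ⟨ξ, η, fun r j => b (.multiplicity r j), hadm, ⟨hbal, fun A => b (.depth A), hconn⟩,
      fun i => ?_⟩
    simp only [hf i, hletters, sum_letters_eq ξ η (Ψ i) fun r j => b (.multiplicity r j)]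

end Semantics

section Size

theorem sum_le_mul {ι : Type*} {t : Finset ι} {F : ι → ℕ} {c e : ℕ} (hc : t.card ≤ c)
    (hF : ∀ i ∈ t, F i ≤ e) : ∑ i ∈ t, F i ≤ c * e :=
  (Finset.sum_le_card_nsmul t F e hF).trans (Nat.mul_le_mul_right e hc)

section Grammar

variable [Fintype X] [Fintype N]

theorem sum_size_productions_le : ∑ r : G.productions, r.1.size ≤ G.size := by
  rw [Finset.sum_coe_sort G.productions Production.size]
  exact Nat.le_add_left _ _

theorem size_production_le (r : G.productions) : r.1.size ≤ G.size :=
  (Finset.single_le_sum (fun _ _ => Nat.zero_le _) (Finset.mem_univ r)).trans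
    G.sum_size_productions_le

theorem length_rhs_le (r : G.productions) : r.1.rhs.length ≤ G.size := by
  have := G.size_production_le r
  rw [Production.size] at this
  omega

theorem size_guard_le (r : G.productions) : r.1.guard.size ≤ G.size := by
  have := G.size_production_le r
  rw [Production.size] at this
  omega

theorem card_nonterminals_le : Fintype.card N ≤ G.size := by
  rw [size]
  omega

theorem card_productions_le : Fintype.card G.productions ≤ G.size := by
  rw [Fintype.card_eq_sum_ones]
  refine le_trans (Finset.sum_le_sum fun r _ => ?_) G.sum_size_productions_le
  rw [Production.size]
  omega

theorem card_position_le : Fintype.card G.Position ≤ G.size := by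
  simp only [Fintype.card_sigma, Fintype.card_fin]
  refine le_trans (Finset.sum_le_sum fun r _ => ?_) G.sum_size_productions_le
  rw [Production.size]
  omega

theorem card_position_prod_fin_le :
    (Finset.univ : Finset (G.Position × Fin m)).card ≤ G.size * m := by
  rw [Finset.card_univ, Fintype.card_prod, Fintype.card_fin]
  exact Nat.mul_le_mul_right _ G.card_position_le

end Grammar

@[simp] theorem termSize_usesTerm (r : G.productions) :
    termSize (G.usesTerm m n r) = 1 + m * 2 := by
  simp [usesTerm, termSize]

variable {m n} [Fintype X] [Fintype N] {s : ℕ}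

theorem size_guardFormula_le (hs : G.size ≤ s) :
    (G.guardFormula m n).size ≤ 3 + s * m * (s + 5) := by
  rw [guardFormula, CombinedFormula.size_conj]
  refine Nat.add_le_add_left (sum_le_mul ?_ fun z _ => ?_) 3
  · rw [Finset.card_univ, Fintype.card_prod, Fintype.card_fin]
    exact Nat.mul_le_mul_right _ (G.card_productions_le.trans hs)
  · have := G.size_guard_le z.1
    simp only [CombinedFormula.size, CombinedFormula.size_eq, termSize, termSize_zero,
      QFFormula.size_rename]
    omega

theorem size_lettersFormula_le (Ψ : Fin n → QFFormula L Unit) (hs : G.size ≤ s) (hn : n ≤ s) :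
    (G.lettersFormula m Ψ).size ≤ 3 + s * m * (13 * s + 4) * (1 + ∑ i, (Ψ i).size) := by
  rw [lettersFormula, CombinedFormula.size_conj, mul_assoc]
  refine Nat.add_le_add_left (sum_le_mul ((G.card_position_prod_fin_le m).trans
    (Nat.mul_le_mul_right _ hs)) fun z _ => ?_) 3
  rw [CombinedFormula.size_conj]
  calc _ ≤ 1 + (3 + ∑ i, (13 + 2 * (Ψ i).size)) := by
        gcongr 1 + (3 + ∑ i, ?_) with i
        have := (z.1.1.1.rhs[z.1.2]).size_letterFormula_le (Ψ i)
        simp only [CombinedFormula.size_cond, CombinedFormula.size, CombinedFormula.size_eq,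
          termSize, termSize_zero, QFFormula.size_rename]
        omega
    _ = 4 + 13 * n + 2 * ∑ i, (Ψ i).size := by
        simp only [Finset.sum_add_distrib, ← Finset.mul_sum, Finset.sum_const, Finset.card_univ,
          Fintype.card_fin, smul_eq_mul]
        omega
    _ ≤ (13 * s + 4) * (1 + ∑ i, (Ψ i).size) := by
        nlinarith [Nat.zero_le (∑ i, (Ψ i).size), Nat.zero_le (s * ∑ i, (Ψ i).size)]

theorem size_balanceFormula_le (hs : G.size ≤ s) :
    (G.balanceFormula m n).size ≤
      3 + s * (6 + s * (2 + s * (2 + m * 2)) + s * (2 + m * 2)) := by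
  classical
  have hcard := G.card_productions_le.trans hs
  rw [balanceFormula, CombinedFormula.size_conj]
  refine Nat.add_le_add_left (sum_le_mul (G.card_nonterminals_le.trans hs) fun A _ => ?_) 3
  have hstart : termSize (if A = G.start then 1 else 0 :
      presburger.Term (Fin n ⊕ G.ArithVar m n)) = 1 := by
    split_ifs <;> simp
  have hproduced : ∑ r, (1 + termSize ((G.out r).count A • G.usesTerm m n r)) ≤
      s * (2 + s * (2 + m * 2)) := by
    refine sum_le_mul hcard fun r _ => ?_
    have hcount : (G.out r).count A ≤ s :=
      calc (G.out r).count A ≤ (G.out r).card := Multiset.count_le_card _ _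
        _ ≤ r.1.rhs.length := List.length_filterMap_le _ _
        _ ≤ s := (G.length_rhs_le r).trans hs
    calc 1 + termSize ((G.out r).count A • G.usesTerm m n r)
        = 2 + (G.out r).count A * (2 + m * 2) := by
          rw [termSize_nsmul, termSize_usesTerm]
          ring
      _ ≤ 2 + s * (2 + m * 2) := by gcongr
  have hrewritten : ∑ r with G.lhs r = A, (1 + termSize (G.usesTerm m n r)) ≤
      s * (2 + m * 2) :=
    sum_le_mul ((Finset.card_filter_le _ _).trans hcard) fun r _ => by
      rw [termSize_usesTerm]
      omega
  rw [CombinedFormula.size_eq, termSize_add, termSize_sum, termSize_sum, hstart]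
  omega

theorem size_connectivityFormula_le (hs : G.size ≤ s) :
    (G.connectivityFormula m n).size ≤ 3 + s * (9 + m * 2 + s * (12 + m * 2)) := by
  classical
  have hcard (t : Finset G.productions) : t.card ≤ s :=
    t.card_le_univ.trans (G.card_productions_le.trans hs)
  rw [connectivityFormula, CombinedFormula.size_conj]
  refine Nat.add_le_add_left (sum_le_mul (hcard _) fun r _ => ?_) 3
  simp only [CombinedFormula.size, CombinedFormula.size_eq, CombinedFormula.size_disj, termSize,
    termSize_zero, termSize_one, termSize_add, termSize_usesTerm]
  refine (Nat.add_le_add_left (Nat.add_le_add_left (Nat.add_le_add_left (sum_le_mul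
    (e := 12 + m * 2) (hcard _) fun _ _ => ?_) _) _) _).trans ?_ <;> omega

theorem size_imageFormula_le (hs : G.size ≤ s) (hn : n ≤ s) :
    (G.imageFormula m n).size ≤ 3 + s * (4 + s * m * 2) := by
  rw [imageFormula, CombinedFormula.size_conj]
  refine Nat.add_le_add_left (sum_le_mul (by simpa using hn) fun i _ => ?_) 3
  have hcard := (G.card_position_prod_fin_le m).trans (Nat.mul_le_mul_right _ hs)
  simp only [CombinedFormula.size_eq, termSize_sum, termSize, Finset.sum_const, smul_eq_mul]
  omega

/-- The factor by which `parikhFormula` with `m` copies of the local variables is larger than the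
formulas defining the letter classes, for grammars of size at most `s` and at most `s` classes. It
is a function on an arbitrary semiring so that it also denotes a polynomial. -/
def parikhFormulaBound {R : Type*} [Semiring R] (s m : R) : R :=
  19 + s * m * (s + 5) + s * (6 + s * (2 + s * (2 + m * 2)) + s * (2 + m * 2)) +
    s * (9 + m * 2 + s * (12 + m * 2)) + s * (4 + s * m * 2) + s * m * (13 * s + 4)

theorem eval_parikhFormulaBound (m : Polynomial ℕ) (s : ℕ) :
    (parikhFormulaBound .X m).eval s = parikhFormulaBound s (m.eval s) := by
  simp [parikhFormulaBound]

theorem size_parikhFormula_le (Ψ : Fin n → QFFormula L Unit) (hs : G.size ≤ s) (hn : n ≤ s) :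
    (G.parikhFormula m Ψ).size ≤ parikhFormulaBound s m * (1 + ∑ i, (Ψ i).size) := by
  have hguard := G.size_guardFormula_le (m := m) (n := n) hs
  have hletters := G.size_lettersFormula_le (m := m) Ψ hs hn
  have hbalance := G.size_balanceFormula_le (m := m) (n := n) hs
  have hconnectivity := G.size_connectivityFormula_le (m := m) (n := n) hs
  have himage := G.size_imageFormula_le (m := m) hs hn
  rw [parikhFormulaBound, add_mul]
  refine le_trans ?_ (Nat.add_le_add_right (Nat.le_mul_of_pos_right _ (by omega)) _)
  simp only [parikhFormula, CombinedFormula.size]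
  omega

end Size

end ParametricGrammar

end Encoding

end ParametricParikh

open ParametricParikh in
theorem mainTheorem1 :
    ∃ p : Polynomial ℕ,
      ∀ (L : FirstOrder.Language.{u, v}) (X : Type uX) (Y : Type uY) (N : Type uN)
        [Fintype X] [Fintype N] (G : ParametricGrammar L X Y N)
        (n : ℕ) (Ψ : Fin n → QFFormula L Unit),
        ∃ φ : ExistentialFormula L n,
          φ.size ≤ p.eval (G.size + n) * (1 + ∑ i, (Ψ i).size) ∧
          ∀ (D : Type w) [Nonempty D] [L.Structure D] (f : Fin n → ℕ),
            f ∈ parikhImage Ψ (G.language D) ↔ φ.Holds D f := by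
  let copies : Polynomial ℕ := 4 * .X ^ 2 * (.X + 2)
  refine ⟨2 * ParametricGrammar.parikhFormulaBound .X copies + 2, fun L X Y N _ _ G n Ψ => ?_⟩
  have hcopies : 4 * (Fintype.card G.productions + n) ^ 2 * (G.size + 2) ≤
      copies.eval (G.size + n) := by
    have := G.card_productions_le
    simp only [copies, Polynomial.eval_mul, Polynomial.eval_pow, Polynomial.eval_add,
      Polynomial.eval_X, Polynomial.eval_ofNat]
    gcongr
    omega
  obtain ⟨φ, hsize, hφ⟩ := exists_existentialFormula (G.parikhFormula (copies.eval (G.size + n)) Ψ)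
  refine ⟨φ, ?_, fun D _ _ f => ?_⟩
  · have hmatrix := G.size_parikhFormula_le (m := copies.eval (G.size + n)) Ψ
      (Nat.le_add_right G.size n) (Nat.le_add_left n G.size)
    simp only [Polynomial.eval_add, Polynomial.eval_mul, Polynomial.eval_ofNat,
      ParametricGrammar.eval_parikhFormulaBound, add_mul, mul_assoc]
    omega
  · rw [ParametricGrammar.mem_parikhImage_iff_exists_holds f G.length_rhs_le hcopies, hφ]
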